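/- Let $m\ge 1$ and let $G_m=\mathbb Z^m *_{g\mapsto g^3}=\langle a_1,\dots,a_m,t \mid [a_i,a_j]=1,\ t a_i t^{-1}=a_i^3\rangle$ be the HNN extension of $\mathbb Z^m=\langle a_1,\dots,a_m\rangle$ given by the cubing map. Words are over the letters $a_i$, $A_i=a_i^{-1}$, $t$, $T=t^{-1}$; a word is geodesic if no word spelling the same element of $G_m$ is shorter. The positive orthant $\mathbb Z_+^m\subset G_m$ is the set of all $a_1^{x_1}\cdots a_m^{x_m}$ with all $x_i\ge 1$. For $X\subseteq\{1,\dots,m\}$ define the following sets of words, where all products are taken over $i\in X$ in increasing order: $W_X=\{\prod a_i^{e_i} : e_i\in\{-1,0,1\}\}$, with $a_i^{-1}$ written $A_i$; $U_X=\{\prod a_i\}$; $U_X^2=\{\prod a_ia_i\}$; $U_X^{-1}=\{\prod A_i\}$; and $$V_X=\bigl(U_X^2\cup tU_XTW_X\bigr)\setminus tU_XTU_X^{-1}.$$ Let $n\ge 0$. A partition of $(m,n)$ is a finite sequence of pairs $(i_1,j_1),\dots,(i_q,j_q)$, $q\ge 1$, of integers with $i_k\ge 1$, $j_k\ge 0$,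 $\sum_k i_k=m$ and $\sum_k j_k=n$. Put $s_k=i_1+\dots+i_k$ and $\Delta_k=\{s_{k-1}+1,\dots,s_k\}$, with $s_0=0$. For a permutation $\phi$ of $\{1,\dots,m\}$ put $X_k=\phi(\Delta_k)$, $Y_k=X_1\cup\dots\cup X_k$ (so $Y_q=\{1,\dots,m\}$), and let $$L_{\phi,(i,j)}=t^n\,V_{X_1}(TW_{Y_1})^{j_1}\,U_{X_2}(TW_{Y_2})^{j_2}\cdots U_{X_q}(TW_{Y_q})^{j_q}.$$ Let $\tilde L_m$ be the union of $U_{\{1,\dots,m\}}$ and of all $L_{\phi,(i,j)}$, over all $n\ge 0$, all permutations $\phi$ and all partitions of $(m,n)$. Let $L_m\subseteq\tilde L_m$ be the same union restricted to the partitions with $j_k\ge 1$ for all $1<k<q$ (so that no two factors $U_X,U_{X'}$ are adjacent). **Theorem.** Every word in $L_m$ is geodesic, and sending a word to the element it spells is a bijection from $L_m$ onto the positive orthant $\mathbb Z_+^m$. Moreover, every word in the larger language $\tilde L_m$ is geodesic as well, and the set of elements spelled by $\tilde L_m$ is again $\mathbb Z_+^m$. -/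

import Mathlib

/-- The cubing endomorphism `g ↦ g³` of `ℤ^m` (written multiplicatively). -/
def cubing (m : ℕ) : Multiplicative (Fin m → ℤ) →* Multiplicative (Fin m → ℤ) :=
  powMonoidHom 3

theorem cubing_injective (m : ℕ) : Function.Injective (cubing m) := by
  intro x y h
  have h' : (3 : ℕ) • Multiplicative.toAdd x = (3 : ℕ) • Multiplicative.toAdd y :=
    congrArg Multiplicative.toAdd h
  apply Multiplicative.toAdd.injective
  funext i
  have hi := congrFun h' i
  simp only [Pi.smul_apply, nsmul_eq_mul, Nat.cast_ofNat] at hi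
  omega

/-- The cubing isomorphism of `ℤ^m` onto its image. -/
noncomputable def cubingEquiv (m : ℕ) :
    (⊤ : Subgroup (Multiplicative (Fin m → ℤ))) ≃* (cubing m).range :=
  Subgroup.topEquiv.trans (MonoidHom.ofInjective (cubing_injective m))

/-- The HNN extension `ℤ^m *_{g ↦ g³}`: a stable letter `t` is adjoined to `ℤ^m`, subject to
`t g t⁻¹ = g³` for all `g ∈ ℤ^m`. -/
abbrev CubingExtension (m : ℕ) : Type :=
  HNNExtension (Multiplicative (Fin m → ℤ)) ⊤ (cubing m).range (cubingEquiv m)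

/-- The inclusion of the horocyclic subgroup `ℤ^m`; the vector `x` is sent to
`a₁ ^ x₁ ⋯ aₘ ^ xₘ`. -/
noncomputable def horocyclic {m : ℕ} (x : Fin m → ℤ) : CubingExtension m :=
  HNNExtension.of (Multiplicative.ofAdd x)

/-- The positive orthant `ℤ₊^m` of the horocyclic subgroup. -/
def positiveOrthant (m : ℕ) : Set (CubingExtension m) :=
  {g | ∃ x : Fin m → ℤ, (∀ i, 0 < x i) ∧ g = horocyclic x}

/-- The letters `aᵢ`, `Aᵢ = aᵢ⁻¹`, `t`, `T = t⁻¹`. -/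
inductive Letter (m : ℕ) : Type
  | a (i : Fin m) : Letter m
  | A (i : Fin m) : Letter m
  | t : Letter m
  | T : Letter m

/-- The group element that a letter stands for. -/
noncomputable def Letter.eval {m : ℕ} : Letter m → CubingExtension m
  | .a i => horocyclic (Pi.single i 1)
  | .A i => (horocyclic (Pi.single i 1))⁻¹
  | .t => HNNExtension.t
  | .T => HNNExtension.t⁻¹

/-- The group element spelled by a word. -/
noncomputable def evalWord {m : ℕ} (w : List (Letter m)) : CubingExtension m :=
  (w.map Letter.eval).prod

/-- A word is geodesic if no word spelling the same group element is shorter. -/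
def IsGeodesic {m : ℕ} (w : List (Letter m)) : Prop :=
  ∀ w' : List (Letter m), evalWord w' = evalWord w → w.length ≤ w'.length

/-- The word `aᵢ ^ e` for `e ∈ {-1, 0, 1}`. -/
def digitWord {m : ℕ} (i : Fin m) : SignType → List (Letter m)
  | .neg => [.A i]
  | .zero => []
  | .pos => [.a i]

/-- The set `W_X` of words `∏ aᵢ ^ eᵢ`, `eᵢ ∈ {-1, 0, 1}`, where `i` runs through `X` in
increasing order. -/
def langW {m : ℕ} (X : Finset (Fin m)) : Language (Letter m) :=
  {w | ∃ e : Fin m → SignType, w = (X.sort (· ≤ ·)).flatMap fun i => digitWord i (e i)}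

/-- The one-element set `U_X`, consisting of the word `∏ aᵢ`, where `i` runs through `X` in
increasing order. -/
def langU {m : ℕ} (X : Finset (Fin m)) : Language (Letter m) :=
  {(X.sort (· ≤ ·)).map Letter.a}

/-- The set `U_X²`, consisting of the word `∏ aᵢ²`. -/
def langUsq {m : ℕ} (X : Finset (Fin m)) : Language (Letter m) :=
  {(X.sort (· ≤ ·)).flatMap fun i => [Letter.a i, Letter.a i]}

/-- The set `U_X⁻¹`, consisting of the word `∏ Aᵢ`, spelled in the same order as in `W_X`. -/
def langUinv {m : ℕ} (X : Finset (Fin m)) : Language (Letter m) :=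
  {(X.sort (· ≤ ·)).map Letter.A}

/-- The one-word language `{t}`. -/
def langt (m : ℕ) : Language (Letter m) := {[Letter.t]}

/-- The one-word language `{T}`. -/
def langT (m : ℕ) : Language (Letter m) := {[Letter.T]}

/-- The set of caps `V_X = (U_X² ∪ t U_X T W_X) \ t U_X T U_X⁻¹`. -/
def langV {m : ℕ} (X : Finset (Fin m)) : Language (Letter m) :=
  {w | (w ∈ langUsq X ∨ w ∈ langt m * langU X * langT m * langW X) ∧
    w ∉ langt m * langU X * langT m * langUinv X}

/-- The image under `φ` of the range of the `i` consecutive indices that follow the first `s`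
indices. -/
def block {m : ℕ} (φ : Equiv.Perm (Fin m)) (s i : ℕ) : Finset (Fin m) :=
  (Finset.univ.filter fun x : Fin m => s ≤ (x : ℕ) ∧ (x : ℕ) < s + i).map φ.toEmbedding

/-- The factors `U_{φ(Δi₂)} (T W_{φ(Δi₁) ∪ φ(Δi₂)})^{j₂} ⋯ U_{φ(Δi_q)} (T W_m)^{j_q}` determined
by the list of pairs `(i₂, j₂), …, (i_q, j_q)`, where `s` counts the indices used so far. -/
def langTail {m : ℕ} (φ : Equiv.Perm (Fin m)) : ℕ → List (ℕ × ℕ) → Language (Letter m)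
  | _, [] => 1
  | s, (i, j) :: P =>
      langU (block φ s i) * (langT m * langW (block φ 0 (s + i))) ^ j * langTail φ (s + i) P

/-- The language
`tⁿ V_{φ(Δi₁)} (T W_{φ(Δi₁)})^{j₁} U_{φ(Δi₂)} (T W_{φ(Δi₁) ∪ φ(Δi₂)})^{j₂} ⋯`
determined by `φ` and the list of pairs `(i₁, j₁), P = [(i₂, j₂), …, (i_q, j_q)]`. -/
def langPiece {m : ℕ} (n : ℕ) (φ : Equiv.Perm (Fin m)) (p : ℕ × ℕ) (P : List (ℕ × ℕ)) :
    Language (Letter m) :=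
  langt m ^ n * langV (block φ 0 p.1) * (langT m * langW (block φ 0 p.1)) ^ p.2 *
    langTail φ p.1 P

/-- A list of pairs `(i₁, j₁), …, (i_q, j_q)` is a partition of `(m, n)` if the `i_k` are positive
with sum `m` and the `j_k` are non-negative with sum `n`. -/
def IsPairPartition (m n : ℕ) (Q : List (ℕ × ℕ)) : Prop :=
  (∀ p ∈ Q, 0 < p.1) ∧ (Q.map Prod.fst).sum = m ∧ (Q.map Prod.snd).sum = n

/-- The language obtained from all partitions of `(m, n)`, `n ≥ 0`, together with `U_m`. It may
contain several words that differ only in how adjacent factors `U_X U_Y` are ordered. -/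
def fullLanguage (m : ℕ) : Language (Letter m) :=
  {w | w ∈ langU (Finset.univ : Finset (Fin m)) ∨
    ∃ (n : ℕ) (φ : Equiv.Perm (Fin m)) (p : ℕ × ℕ) (P : List (ℕ × ℕ)),
      IsPairPartition m n (p :: P) ∧ w ∈ langPiece n φ p P}

/-- The language `L_m`: only partitions `(i₁, j₁), …, (i_q, j_q)` with `j_k > 0` for all
`1 < k < q` are used, so that no two factors `U_X`, `U_Y` are adjacent. -/
def normalLanguage (m : ℕ) : Language (Letter m) :=
  {w | w ∈ langU (Finset.univ : Finset (Fin m)) ∨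
    ∃ (n : ℕ) (φ : Equiv.Perm (Fin m)) (p : ℕ × ℕ) (P : List (ℕ × ℕ)),
      IsPairPartition m n (p :: P) ∧ (∀ r ∈ P.dropLast, 0 < r.2) ∧ w ∈ langPiece n φ p P}

/-!
Under the action of the group on `ℚ^m` by affine maps (`affineAction`), a word describes a path of
heights, and a letter `aᵢ^{±1}` at height `h` contributes `± 3 ^ h` to coordinate `i`. A word that
spells `x ∈ ℤ^m` is therefore a way to write the coordinates as `xᵢ = ∑ c h * 3 ^ h`; it costs one
letter for each unit of each `|c h|`, and two letters `t`, `T` for each height visited besides `0`.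
Negative heights do not help, because the contributions there can be collected at height `0`. If
the heights up to `M` are available, the cheapest expansion of an integer has balanced ternary
digits below `M` and the remaining quotient at `M`; its cost is `ternaryCost M`. Hence every word
for `x` has at least `2 * M + ∑ i, ternaryCost M (x i)` letters for some `M`
(`exists_cost_le_length`).

For positive `x`, this bound is smallest at the `M` where all that is left of each coordinate
after `M` digits is `0` or `1`, or one position earlier if there the largest coordinates all have
the value `2`: while a coordinate is at least `2` after the next digit, one more position saves at
least two letters (`ternaryCost_succ_add_two_le`). The caps `V_X` implement precisely this choice
(`length_capWord_le`). So each positive vector other than `(1, …, 1)` has a well-defined word,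
`orthantWord`, which spells it (`evalWord_orthantWord`) and attains the bound
(`length_orthantWord_le`).

It remains to compare the language with these words. The factors `U_X` introduce the leading digits
of the coordinates in `X`, and the factors `T W_Y` multiply by `3` and add balanced digits, so the
data `φ`, `(i, j)` of a word of the full language are the leading positions of a vector, and the
word differs from `orthantWord` at most by the order of letters inside a run `U_X U_Y`; for a word
of the normal language there is no such run (`exists_wordEquiv_orthantWord`). Conversely, listing
the coordinates by decreasing position of the leading digit shows that `orthantWord` is in the
normal language (`orthantWord_mem_normalLanguage`). Since the position `n` of the cap is
determined by `x` (`le_of_vecShift_bounds`), evaluation is injective on the normal language.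
-/

/-! ### Balanced ternary expansions -/

/-- The quotient of the division by `3` with remainder in `{-1, 0, 1}`. -/
def ternaryQuot (x : ℤ) : ℤ := (x + 1) / 3

/-- The last digit of the balanced ternary expansion. -/
noncomputable def ternaryDigit (x : ℤ) : SignType := SignType.sign (x - 3 * ternaryQuot x)

/-- What is left of `x` after deleting the last `r` digits of its balanced ternary expansion. -/
def ternaryShift (r : ℕ) (x : ℤ) : ℤ := ternaryQuot^[r] x

/-- The least value of `∑ |c h|` over all expansions `x = ∑ h ∈ {0, …, M}, c h * 3 ^ h`. It is
computed greedily: balanced digits below the position `M`, and the rest at position `M`. -/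
def ternaryCost : ℕ → ℤ → ℤ
  | 0, x => |x|
  | M + 1, x => |x - 3 * ternaryQuot x| + ternaryCost M (ternaryQuot x)

theorem ternaryCost_succ (M : ℕ) (x : ℤ) :
    ternaryCost (M + 1) x = |x - 3 * ternaryQuot x| + ternaryCost M (ternaryQuot x) := rfl

theorem three_mul_ternaryQuot_le (x : ℤ) : 3 * ternaryQuot x ≤ x + 1 := by
  unfold ternaryQuot; omega

theorem le_three_mul_ternaryQuot (x : ℤ) : x - 1 ≤ 3 * ternaryQuot x := by
  unfold ternaryQuot; omega

theorem ternaryQuot_eq {x y : ℤ} (h₁ : 3 * y ≤ x + 1) (h₂ : x ≤ 3 * y + 1) :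
    ternaryQuot x = y := by
  unfold ternaryQuot; omega

theorem ternaryQuot_mono : Monotone ternaryQuot := fun x y h => by
  unfold ternaryQuot; omega

theorem coe_ternaryDigit (x : ℤ) : (ternaryDigit x : ℤ) = x - 3 * ternaryQuot x := by
  have h₁ := three_mul_ternaryQuot_le x
  have h₂ := le_three_mul_ternaryQuot x
  rw [ternaryDigit]
  obtain h | h | h : x - 3 * ternaryQuot x = -1 ∨ x - 3 * ternaryQuot x = 0 ∨
    x - 3 * ternaryQuot x = 1 := by omega
  all_goals rw [h]; decide

theorem signType_coe_cases (e : SignType) : (e : ℤ) = -1 ∨ (e : ℤ) = 0 ∨ (e : ℤ) = 1 := by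
  cases e <;> simp

theorem signType_coe_injective : Function.Injective ((↑) : SignType → ℤ) := by decide

theorem ternaryQuot_add_sign (y : ℤ) (e : SignType) : ternaryQuot (3 * y + e) = y := by
  have := signType_coe_cases e
  apply ternaryQuot_eq <;> omega

theorem ternaryDigit_add_sign (y : ℤ) (e : SignType) : ternaryDigit (3 * y + e) = e := by
  apply signType_coe_injective
  rw [coe_ternaryDigit, ternaryQuot_add_sign]
  ring

@[simp] theorem ternaryShift_zero (x : ℤ) : ternaryShift 0 x = x := rfl

theorem ternaryShift_succ (r : ℕ) (x : ℤ) :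
    ternaryShift (r + 1) x = ternaryQuot (ternaryShift r x) :=
  Function.iterate_succ_apply' _ _ _

theorem ternaryShift_succ' (r : ℕ) (x : ℤ) :
    ternaryShift (r + 1) x = ternaryShift r (ternaryQuot x) :=
  Function.iterate_succ_apply _ _ _

theorem ternaryShift_mono (r : ℕ) : Monotone (ternaryShift r) := ternaryQuot_mono.iterate r

theorem ternaryShift_nonneg (r : ℕ) {x : ℤ} (hx : 0 ≤ x) : 0 ≤ ternaryShift r x := by
  induction r with
  | zero => exact hx
  | succ r ih =>
    have := le_three_mul_ternaryQuot (ternaryShift r x)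
    rw [ternaryShift_succ]
    omega

theorem ternaryCost_succ_add_sign (M : ℕ) (y : ℤ) (e : SignType) :
    ternaryCost (M + 1) (3 * y + e) = |(e : ℤ)| + ternaryCost M y := by
  rw [ternaryCost, ternaryQuot_add_sign]
  congr 2
  ring

theorem ternaryCost_succ_three_mul (M : ℕ) (y : ℤ) :
    ternaryCost (M + 1) (3 * y) = ternaryCost M y := by
  simpa using ternaryCost_succ_add_sign M y 0

@[simp] theorem ternaryCost_at_zero (M : ℕ) : ternaryCost M 0 = 0 := by
  induction M with
  | zero => rfl
  | succ M ih => simpa [ih] using ternaryCost_succ_three_mul M 0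

@[simp] theorem ternaryCost_at_one (M : ℕ) : ternaryCost M 1 = 1 := by
  cases M with
  | zero => rfl
  | succ M => simpa using ternaryCost_succ_add_sign M 0 1

theorem exists_eq_three_mul_add_sign (x : ℤ) : ∃ (y : ℤ) (e : SignType), x = 3 * y + e :=
  ⟨ternaryQuot x, ternaryDigit x, by rw [coe_ternaryDigit]; ring⟩

/-- Allowing one more position does not raise the cost. -/
theorem ternaryCost_succ_le (M : ℕ) (x : ℤ) : ternaryCost (M + 1) x ≤ ternaryCost M x := by
  induction M generalizing x with
  | zero =>
    have h₁ := three_mul_ternaryQuot_le x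
    have h₂ := le_three_mul_ternaryQuot x
    simp only [ternaryCost]
    grind
  | succ M ih =>
    rw [ternaryCost_succ (M + 1) x, ternaryCost_succ M x]
    linarith [ih (ternaryQuot x)]

theorem ternaryCost_add_one_aux (M : ℕ) (x : ℤ) :
    ternaryCost M (x + 1) ≤ ternaryCost M x + 1 ∧
      ternaryCost M x ≤ ternaryCost M (x + 1) + 1 := by
  induction M generalizing x with
  | zero => simp only [ternaryCost]; grind
  | succ M ih =>
    obtain ⟨y, e, rfl⟩ := exists_eq_three_mul_add_sign x
    have h := ih y
    rw [ternaryCost_succ_add_sign]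
    cases e with
    | neg =>
      have := ternaryCost_succ_three_mul M y
      simp_all
      omega
    | zero =>
      have := ternaryCost_succ_add_sign M y 1
      simp_all
      omega
    | pos =>
      -- A carry: the last digit turns from `1` into `-1`.
      have h' := ternaryCost_succ_add_sign M (y + 1) (-1)
      have e₁ : 3 * y + ((SignType.pos : SignType) : ℤ) + 1 =
          3 * (y + 1) + ((-1 : SignType) : ℤ) := by
        simp; ring
      rw [e₁, h']
      simp
      omega

/-- One more coefficient `±1` at an available position changes the cost by at most `1`. -/
theorem ternaryCost_add_pow {h M : ℕ} (hM : h ≤ M) (x : ℤ) (e : SignType) :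
    ternaryCost M (x + e * 3 ^ h) ≤ ternaryCost M x + 1 := by
  induction h generalizing M x with
  | zero =>
    have h₁ := (ternaryCost_add_one_aux M x).1
    have h₂ := (ternaryCost_add_one_aux M (x - 1)).2
    cases e <;> simp_all [sub_eq_add_neg]
  | succ h ih =>
    obtain ⟨M, rfl⟩ : ∃ k, M = k + 1 := ⟨M - 1, by omega⟩
    obtain ⟨y, d, rfl⟩ := exists_eq_three_mul_add_sign x
    have e₁ : 3 * y + (d : ℤ) + e * 3 ^ (h + 1) = 3 * (y + e * 3 ^ h) + d := by ring
    rw [e₁, ternaryCost_succ_add_sign, ternaryCost_succ_add_sign]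
    linarith [ih (M := M) (by omega) y]

/-- If at least `2` is left after deleting `M + 1` digits, then expanding up to position `M` is
wasteful: the position `M + 1` saves at least `2`. -/
theorem ternaryCost_succ_add_two_le {M : ℕ} {x : ℤ} (hx : 2 ≤ ternaryShift (M + 1) x) :
    ternaryCost (M + 1) x + 2 ≤ ternaryCost M x := by
  induction M generalizing x with
  | zero =>
    have h₁ := three_mul_ternaryQuot_le x
    have h₂ := le_three_mul_ternaryQuot x
    rw [ternaryShift_succ, ternaryShift_zero] at hx
    simp only [ternaryCost]
    grind
  | succ M ih =>
    rw [ternaryShift_succ'] at hx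
    rw [ternaryCost_succ (M + 1) x, ternaryCost_succ M x]
    linarith [ih hx]

/-! ### Lower bound for the length of a word -/

theorem horocyclic_add {m : ℕ} (x y : Fin m → ℤ) :
    horocyclic (x + y) = horocyclic x * horocyclic y := by
  simp [horocyclic]

@[simp] theorem horocyclic_zero {m : ℕ} : horocyclic (0 : Fin m → ℤ) = 1 := by
  simp [horocyclic]

theorem horocyclic_neg {m : ℕ} (x : Fin m → ℤ) : horocyclic (-x) = (horocyclic x)⁻¹ := by
  simp [horocyclic]

@[simp] theorem evalWord_nil {m : ℕ} : evalWord ([] : List (Letter m)) = 1 := rfl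

@[simp] theorem evalWord_append {m : ℕ} (u v : List (Letter m)) :
    evalWord (u ++ v) = evalWord u * evalWord v := by
  simp [evalWord]

@[simp] theorem evalWord_cons {m : ℕ} (l : Letter m) (v : List (Letter m)) :
    evalWord (l :: v) = l.eval * evalWord v := by
  simp [evalWord]

/-- `ℤ^m` acting on `ℚ^m` by translations. -/
def translationHom (m : ℕ) : Multiplicative (Fin m → ℤ) →* Equiv.Perm (Fin m → ℚ) where
  toFun g := Equiv.addLeft fun i => ((Multiplicative.toAdd g i : ℤ) : ℚ)
  map_one' := by ext; simp
  map_mul' g h := by ext; simp; ring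

/-- The action of `ℤ^m *_{g ↦ g³}` on `ℚ^m` by affine maps: `ℤ^m` acts by translations, and `t` is
the multiplication by `3`. -/
noncomputable def affineAction (m : ℕ) : CubingExtension m →* Equiv.Perm (Fin m → ℚ) :=
  HNNExtension.lift (translationHom m)
    (MulAction.toPerm (Units.mk0 (3 : ℚ) (by norm_num))) (by
      rintro ⟨a, ha⟩
      ext v i
      have h : ((cubingEquiv m ⟨a, ha⟩ : (cubing m).range) : Multiplicative (Fin m → ℤ)) =
        a ^ 3 := rfl
      simp [translationHom, h, Units.smul_def])

@[simp] theorem affineAction_horocyclic {m : ℕ} (x : Fin m → ℤ) (v : Fin m → ℚ) (i : Fin m) :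
    affineAction m (horocyclic x) v i = v i + x i := by
  simp [affineAction, horocyclic, translationHom, add_comm]

@[simp] theorem affineAction_t {m : ℕ} (v : Fin m → ℚ) (i : Fin m) :
    affineAction m HNNExtension.t v i = 3 * v i := by
  simp [affineAction, Units.smul_def]

@[simp] theorem affineAction_t_inv {m : ℕ} (v : Fin m → ℚ) (i : Fin m) :
    affineAction m HNNExtension.t⁻¹ v i = v i / 3 := by
  have h := congrFun (congrArg (fun f => f v)
    (congrArg (affineAction m) (mul_inv_cancel (HNNExtension.t : CubingExtension m)))) i
  simp only [map_mul, Equiv.Perm.mul_apply, affineAction_t, map_one, Equiv.Perm.one_apply] at h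
  linarith

theorem horocyclic_injective {m : ℕ} : Function.Injective (horocyclic (m := m)) := by
  intro x y h
  funext i
  have := affineAction_horocyclic x 0 i
  rw [h, affineAction_horocyclic] at this
  exact_mod_cast (add_left_cancel this).symm

/-- The invariant behind the lower bound. Read the word as a path in which a letter `t` or `T`
moves the height up or down by `1`, from height `0` to height `k`, and a letter `aᵢ` or `Aᵢ` at
height `h` contributes `± 3 ^ h` to coordinate `i`. If the heights visited fill the interval from
`-N` to `P`, then there are at least `2 * (N + P) - |k|` letters `t`, `T`, and the contributions,
scaled by `3 ^ N`, need at least `∑ i, ternaryCost (N + P) (z i)` further letters. -/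
theorem exists_affine_cost_le_length {m : ℕ} (w : List (Letter m)) :
    ∃ (N P : ℕ) (k : ℤ) (z : Fin m → ℤ), -(N : ℤ) ≤ k ∧ k ≤ P ∧
      (∀ v i, affineAction m (evalWord w) v i = 3 ^ k * v i + z i / 3 ^ N) ∧
      ∑ i, ternaryCost (N + P) (z i) + (2 * (N + P) - |k|) ≤ w.length := by
  have h3 : (3 : ℚ) ≠ 0 := by norm_num
  induction w with
  | nil => exact ⟨0, 0, 0, 0, by simp⟩
  | cons l w ih =>
    obtain ⟨N, P, k, z, hk, hk', hact, hlen⟩ := ih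
    have key : ∀ (i : Fin m) (e : SignType),
        l.eval = horocyclic (Pi.single i (e : ℤ)) → ∃ (N P : ℕ) (k : ℤ) (z : Fin m → ℤ),
          -(N : ℤ) ≤ k ∧ k ≤ P ∧
          (∀ v i, affineAction m (evalWord (l :: w)) v i = 3 ^ k * v i + z i / 3 ^ N) ∧
          ∑ i, ternaryCost (N + P) (z i) + (2 * (N + P) - |k|) ≤ (l :: w).length := by
      intro i e hl
      refine ⟨N, P, k, z + Pi.single i ((e : ℤ) * 3 ^ N), hk, hk', fun v j => ?_, ?_⟩
      · rw [evalWord_cons, map_mul, Equiv.Perm.mul_apply, hl, affineAction_horocyclic, hact]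
        by_cases hij : j = i
        · subst hij
          simp
          field_simp
          ring
        · simp [Pi.single_eq_of_ne hij]
      · have h₁ : ∑ j, ternaryCost (N + P) ((z + Pi.single i ((e : ℤ) * 3 ^ N) : Fin m → ℤ) j) ≤
            ∑ j, (ternaryCost (N + P) (z j) + if j = i then 1 else 0) := by
          refine Finset.sum_le_sum fun j _ => ?_
          by_cases hij : j = i
          · subst hij
            simpa using ternaryCost_add_pow (Nat.le_add_right N P) (z j) e
          · simp [hij]
        rw [Finset.sum_add_distrib] at h₁
        simp only [Finset.sum_ite_eq', Finset.mem_univ, if_true] at h₁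
        push_cast [List.length_cons]
        linarith
    cases l with
    | a i => exact key i 1 (by simp [Letter.eval])
    | A i => exact key i (-1) (by simp [Letter.eval, Pi.single_neg, horocyclic_neg])
    | t =>
      have hact' : ∀ v i, affineAction m (evalWord (Letter.t :: w)) v i =
          3 ^ (k + 1) * v i + 3 * z i / 3 ^ N := fun v i => by
        rw [evalWord_cons, map_mul, Equiv.Perm.mul_apply, Letter.eval, affineAction_t, hact,
          zpow_add_one₀ h3]
        ring
      cases N with
      | zero =>
        refine ⟨0, P + 1, k + 1, fun i => 3 * z i, by omega, by push_cast; omega, fun v i => ?_, ?_⟩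
        · rw [hact']; push_cast; rfl
        · simp only [zero_add, ternaryCost_succ_three_mul] at hlen ⊢
          push_cast [List.length_cons] at hlen ⊢
          rw [abs_of_nonneg (by omega)] at hlen ⊢
          linarith
      | succ N =>
        refine ⟨N, P + 1, k + 1, z, by omega, by push_cast; omega, fun v i => ?_, ?_⟩
        · rw [hact', pow_succ]
          field_simp
        · rw [show N + (P + 1) = N + 1 + P by ring]
          push_cast [List.length_cons] at hlen ⊢
          grind
    | T =>
      have hact' : ∀ v i, affineAction m (evalWord (Letter.T :: w)) v i =
          3 ^ (k - 1) * v i + z i / 3 ^ (N + 1) := fun v i => by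
        rw [evalWord_cons, map_mul, Equiv.Perm.mul_apply, Letter.eval, affineAction_t_inv, hact,
          zpow_sub_one₀ h3, pow_succ]
        field_simp
      cases P with
      | zero =>
        refine ⟨N + 1, 0, k - 1, z, by push_cast; omega, by omega, hact', ?_⟩
        have h₁ : ∑ i, ternaryCost (N + 1) (z i) ≤ ∑ i, ternaryCost N (z i) :=
          Finset.sum_le_sum fun i _ => ternaryCost_succ_le N (z i)
        simp only [add_zero] at hlen ⊢
        push_cast [List.length_cons] at hlen ⊢
        grind
      | succ P =>
        refine ⟨N + 1, P, k - 1, z, by push_cast; omega, by omega, hact', ?_⟩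
        rw [show N + 1 + P = N + (P + 1) by ring]
        push_cast [List.length_cons] at hlen ⊢
        grind

theorem ternaryCost_pow_mul (N M : ℕ) (x : ℤ) :
    ternaryCost (N + M) (3 ^ N * x) = ternaryCost M x := by
  induction N with
  | zero => simp
  | succ N ih =>
    rw [show N + 1 + M = N + M + 1 by ring, pow_succ', mul_assoc, ternaryCost_succ_three_mul, ih]

theorem exists_cost_le_length {m : ℕ} (hm : 0 < m) {w : List (Letter m)} {x : Fin m → ℤ}
    (hw : evalWord w = horocyclic x) :
    ∃ M : ℕ, 2 * M + ∑ i, ternaryCost M (x i) ≤ w.length := by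
  obtain ⟨N, P, k, z, hk, hk', hact, hlen⟩ := exists_affine_cost_le_length w
  simp only [hw, affineAction_horocyclic] at hact
  have hz : ∀ i, z i = 3 ^ N * x i := fun i => by
    have h := hact 0 i
    simp only [Pi.zero_apply, mul_zero, zero_add] at h
    rw [eq_div_iff (by positivity)] at h
    have : (z i : ℚ) = ((3 ^ N * x i : ℤ) : ℚ) := by push_cast; linarith
    exact_mod_cast this
  have hk0 : k = 0 := by
    have h₀ := hact 0 ⟨0, hm⟩
    have h₁ := hact 1 ⟨0, hm⟩
    simp only [Pi.zero_apply, mul_zero, zero_add, Pi.one_apply, mul_one] at h₀ h₁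
    have h : (3 : ℚ) ^ k = 1 := by linarith
    exact (zpow_eq_one_iff_right₀ (by norm_num) (by norm_num)).1 h
  refine ⟨P, ?_⟩
  subst hk0
  simp only [hz, ternaryCost_pow_mul] at hlen
  simp at hlen
  omega

/-- A word that is as cheap as every expansion of the coordinates is geodesic. -/
theorem isGeodesic_of_length_le_cost {m : ℕ} (hm : 0 < m) {w : List (Letter m)} {x : Fin m → ℤ}
    (hw : evalWord w = horocyclic x)
    (hlen : ∀ M : ℕ, (w.length : ℤ) ≤ 2 * M + ∑ i, ternaryCost M (x i)) : IsGeodesic w := by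
  intro w' h
  obtain ⟨M, hM⟩ := exists_cost_le_length hm (h.trans hw)
  exact_mod_cast (hlen M).trans hM

/-! ### Evaluation and length of words in the horocyclic letters -/

/-- The word `∏ aᵢ ^ eᵢ`, where `i` runs through `X` in increasing order. It spans both the words
of `langW X` and, for the constant signs `1` and `-1`, those of `langU X` and `langUinv X`. -/
def signWord {m : ℕ} (X : Finset (Fin m)) (e : Fin m → SignType) : List (Letter m) :=
  (X.sort (· ≤ ·)).flatMap fun i => digitWord i (e i)

theorem signWord_one {m : ℕ} (X : Finset (Fin m)) :
    signWord X 1 = (X.sort (· ≤ ·)).map Letter.a := by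
  rw [List.map_eq_flatMap]; rfl

theorem signWord_neg_one {m : ℕ} (X : Finset (Fin m)) :
    signWord X (-1) = (X.sort (· ≤ ·)).map Letter.A := by
  rw [List.map_eq_flatMap]; rfl

theorem signWord_congr {m : ℕ} {X : Finset (Fin m)} {e f : Fin m → SignType}
    (h : ∀ i ∈ X, e i = f i) : signWord X e = signWord X f :=
  List.flatMap_congr fun i hi => by rw [h i ((Finset.mem_sort _).1 hi)]

@[simp] theorem signWord_empty {m : ℕ} (e : Fin m → SignType) : signWord ∅ e = [] := by
  simp [signWord]

theorem sum_map_sort {m : ℕ} {M : Type*} [AddCommMonoid M] (X : Finset (Fin m)) (f : Fin m → M) :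
    ((X.sort (· ≤ ·)).map f).sum = ∑ i ∈ X, f i := by
  rw [← List.sum_toFinset f (X.sort_nodup (· ≤ ·)), Finset.sort_toFinset]

theorem evalWord_flatMap {m : ℕ} (l : List (Fin m)) (f : Fin m → List (Letter m))
    (g : Fin m → Fin m → ℤ) (h : ∀ i, evalWord (f i) = horocyclic (g i)) :
    evalWord (l.flatMap f) = horocyclic (l.map g).sum := by
  induction l with
  | nil => simp
  | cons i l ih => simp [h, ih, horocyclic_add]

theorem evalWord_digitWord {m : ℕ} (i : Fin m) (e : SignType) :
    evalWord (digitWord i e) = horocyclic (Pi.single i (e : ℤ)) := by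
  cases e <;> simp [digitWord, Letter.eval, Pi.single_neg, horocyclic_neg]

theorem sum_single_apply {m : ℕ} (X : Finset (Fin m)) (f : Fin m → ℤ) :
    ∑ i ∈ X, (Pi.single i (f i) : Fin m → ℤ) = fun i => if i ∈ X then f i else 0 := by
  funext j
  simp [Finset.sum_apply, Pi.single_apply]

theorem evalWord_signWord {m : ℕ} (X : Finset (Fin m)) (e : Fin m → SignType) :
    evalWord (signWord X e) = horocyclic fun i => if i ∈ X then (e i : ℤ) else 0 := by
  rw [signWord, evalWord_flatMap _ _ _ fun i => evalWord_digitWord i (e i), sum_map_sort,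
    sum_single_apply]

theorem evalWord_square {m : ℕ} (X : Finset (Fin m)) :
    evalWord ((X.sort (· ≤ ·)).flatMap fun i => [Letter.a i, Letter.a i]) =
      horocyclic fun i => if i ∈ X then 2 else 0 := by
  rw [evalWord_flatMap _ _ (fun i => Pi.single i 2), sum_map_sort, sum_single_apply]
  intro i
  simp [Letter.eval, ← horocyclic_add, ← Pi.single_add]

theorem length_digitWord {m : ℕ} (i : Fin m) (e : SignType) :
    ((digitWord i e).length : ℤ) = |(e : ℤ)| := by
  cases e <;> simp [digitWord]

theorem length_signWord {m : ℕ} (X : Finset (Fin m)) (e : Fin m → SignType) :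
    ((signWord X e).length : ℤ) = ∑ i, if i ∈ X then |(e i : ℤ)| else 0 := by
  rw [signWord, List.length_flatMap, sum_map_sort]
  simp [length_digitWord]

theorem length_square {m : ℕ} (X : Finset (Fin m)) :
    ((((X.sort (· ≤ ·)).flatMap fun i => [Letter.a i, Letter.a i]).length : ℕ) : ℤ) =
      ∑ i, if i ∈ X then 2 else 0 := by
  rw [List.length_flatMap, sum_map_sort]
  simp

theorem t_mul_horocyclic {m : ℕ} (y : Fin m → ℤ) :
    HNNExtension.t * horocyclic y = horocyclic (fun i => 3 * y i) * HNNExtension.t := by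
  have h := HNNExtension.t_mul_of (A := ⊤) (B := (cubing m).range) (φ := cubingEquiv m)
    ⟨Multiplicative.ofAdd y, Subgroup.mem_top _⟩
  have h3 : ((cubingEquiv m ⟨Multiplicative.ofAdd y, Subgroup.mem_top _⟩ : (cubing m).range) :
      Multiplicative (Fin m → ℤ)) = Multiplicative.ofAdd fun i => 3 * y i := by
    change (Multiplicative.ofAdd y) ^ 3 = _
    rw [← ofAdd_nsmul]
    congr 1
  rw [h3] at h
  exact h

theorem t_pow_succ_mul {m : ℕ} (r : ℕ) (y : Fin m → ℤ) (g : CubingExtension m) :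
    HNNExtension.t ^ (r + 1) * horocyclic y * (HNNExtension.t⁻¹ * g) =
      HNNExtension.t ^ r * horocyclic (fun i => 3 * y i) * g := by
  rw [pow_succ, mul_assoc (HNNExtension.t ^ r), t_mul_horocyclic]
  group

/-! ### The word of a vector -/

/-- The vector left after deleting the last `r` digits of each coordinate. -/
def vecShift {m : ℕ} (r : ℕ) (x : Fin m → ℤ) : Fin m → ℤ := fun i => ternaryShift r (x i)

/-- The coordinates that are positive. -/
def posSupport {m : ℕ} (y : Fin m → ℤ) : Finset (Fin m) := Finset.univ.filter fun i => 0 < y i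

/-- The coordinates that are equal to `1`. For a vector `vecShift r x` with `0 ≤ x`, they are the
coordinates of `x` whose leading digit is at position `r`. -/
def oneSupport {m : ℕ} (y : Fin m → ℤ) : Finset (Fin m) := Finset.univ.filter fun i => y i = 1

/-- The coordinates that are at least `2`. -/
def bigSupport {m : ℕ} (y : Fin m → ℤ) : Finset (Fin m) := Finset.univ.filter fun i => 2 ≤ y i

@[simp] theorem mem_posSupport {m : ℕ} {y : Fin m → ℤ} {i : Fin m} :
    i ∈ posSupport y ↔ 0 < y i := by simp [posSupport]

@[simp] theorem mem_oneSupport {m : ℕ} {y : Fin m → ℤ} {i : Fin m} :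
    i ∈ oneSupport y ↔ y i = 1 := by simp [oneSupport]

@[simp] theorem mem_bigSupport {m : ℕ} {y : Fin m → ℤ} {i : Fin m} :
    i ∈ bigSupport y ↔ 2 ≤ y i := by simp [bigSupport]

@[simp] theorem vecShift_zero {m : ℕ} (x : Fin m → ℤ) : vecShift 0 x = x := rfl

theorem vecShift_succ_apply {m : ℕ} (r : ℕ) (x : Fin m → ℤ) (i : Fin m) :
    vecShift (r + 1) x i = ternaryQuot (vecShift r x i) := ternaryShift_succ r (x i)

theorem vecShift_nonneg {m : ℕ} (r : ℕ) {x : Fin m → ℤ} (hx : 0 ≤ x) : 0 ≤ vecShift r x :=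
  fun i => ternaryShift_nonneg r (hx i)

theorem posSupport_vecShift_succ {m : ℕ} (r : ℕ) (x : Fin m → ℤ) :
    posSupport (vecShift (r + 1) x) = bigSupport (vecShift r x) := by
  ext i
  rw [mem_posSupport, mem_bigSupport, vecShift_succ_apply, ternaryQuot]
  omega

/-- The letters that take `vecShift r x` to `x`: in each step a letter `T`, the next digits of the
coordinates whose expansion has begun, and a letter for each expansion that begins here. -/
noncomputable def tailWord {m : ℕ} (x : Fin m → ℤ) : ℕ → List (Letter m)
  | 0 => []
  | r + 1 => Letter.T ::
      (signWord (bigSupport (vecShift r x)) (fun i => ternaryDigit (vecShift r x i)) ++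
        (signWord (oneSupport (vecShift r x)) 1 ++ tailWord x r))

open Classical in
/-- The word of `V_X` for the coordinates of `y` in `X = bigSupport y`, when these are in
`{2, 3, 4}`. -/
noncomputable def capWord {m : ℕ} (y : Fin m → ℤ) : List (Letter m) :=
  if ∀ i, 2 ≤ y i → y i = 2 then
    ((bigSupport y).sort (· ≤ ·)).flatMap fun i => [Letter.a i, Letter.a i]
  else
    Letter.t :: (signWord (bigSupport y) 1 ++
      (Letter.T :: signWord (bigSupport y) fun i => ternaryDigit (y i)))

/-- The word of the language for the vector `x`, where `n` is one less than the highest position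
of a digit in `x`. -/
noncomputable def orthantWord {m : ℕ} (n : ℕ) (x : Fin m → ℤ) : List (Letter m) :=
  List.replicate n Letter.t ++
    (capWord (vecShift n x) ++ (signWord (oneSupport (vecShift n x)) 1 ++ tailWord x n))

theorem coe_ternaryDigit_of_le_four {z : ℤ} (h₂ : 2 ≤ z) (h₄ : z ≤ 4) :
    (ternaryDigit z : ℤ) = z - 3 := by
  rw [coe_ternaryDigit, ternaryQuot_eq (y := 1)] <;> omega

theorem evalWord_capWord {m : ℕ} {y : Fin m → ℤ} (hy : ∀ i, y i ≤ 4) :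
    evalWord (capWord y) = horocyclic fun i => if 2 ≤ y i then y i else 0 := by
  rw [capWord]
  split_ifs with h
  · rw [evalWord_square]
    congr 1
    funext i
    simp only [mem_bigSupport]
    split_ifs with hi
    exacts [(h i hi).symm, rfl]
  · have h₁ := t_pow_succ_mul 0
      (fun i => if i ∈ bigSupport y then (((1 : Fin m → SignType) i : SignType) : ℤ) else 0)
      (evalWord (signWord (bigSupport y) fun i => ternaryDigit (y i)))
    simp only [pow_zero, one_mul, zero_add, pow_one] at h₁
    simp only [evalWord_cons, evalWord_append, evalWord_signWord, Letter.eval] at h₁ ⊢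
    rw [← mul_assoc, h₁, ← horocyclic_add]
    congr 1
    funext i
    simp only [mem_bigSupport, Pi.add_apply]
    split_ifs with hi
    · rw [coe_ternaryDigit_of_le_four hi (hy i)]
      simp
    · simp

/-- One step of `tailWord`: the recursion `x = 3 * quotient + digit`, where a coordinate that is
`1` gets its value from the letter of its own instead of a digit. -/
theorem vecShift_eq {m : ℕ} (r : ℕ) {x : Fin m → ℤ} (hx : 0 ≤ x) (i : Fin m) :
    3 * vecShift (r + 1) x i +
      ((if i ∈ bigSupport (vecShift r x) then (ternaryDigit (vecShift r x i) : ℤ) else 0) +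
        if i ∈ oneSupport (vecShift r x) then 1 else 0) = vecShift r x i := by
  have h := vecShift_nonneg r hx i
  simp only [mem_bigSupport, mem_oneSupport, coe_ternaryDigit, vecShift_succ_apply]
  simp only [Pi.zero_apply] at h
  have h₁ := three_mul_ternaryQuot_le (vecShift r x i)
  have h₂ := le_three_mul_ternaryQuot (vecShift r x i)
  split_ifs <;> omega

theorem evalWord_tailWord {m : ℕ} {x : Fin m → ℤ} (hx : 0 ≤ x) (r : ℕ) :
    HNNExtension.t ^ r * horocyclic (vecShift r x) * evalWord (tailWord x r) = horocyclic x := by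
  induction r with
  | zero => simp [tailWord]
  | succ r ih =>
    rw [tailWord, evalWord_cons, Letter.eval, t_pow_succ_mul, evalWord_append, evalWord_append,
      evalWord_signWord, evalWord_signWord, ← mul_assoc (horocyclic _) (horocyclic _),
      ← horocyclic_add, mul_assoc, ← mul_assoc (horocyclic _) (horocyclic _), ← horocyclic_add,
      ← mul_assoc]
    refine Eq.trans ?_ ih
    congr 3
    exact funext (vecShift_eq r hx)

theorem evalWord_orthantWord {m n : ℕ} {x : Fin m → ℤ} (hx : 0 ≤ x)
    (h₄ : ∀ i, vecShift n x i ≤ 4) : evalWord (orthantWord n x) = horocyclic x := by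
  rw [orthantWord, evalWord_append, evalWord_append, evalWord_append, evalWord_capWord h₄,
    evalWord_signWord, ← mul_assoc (horocyclic _), ← horocyclic_add, ← mul_assoc]
  have h : (fun i => if 2 ≤ vecShift n x i then vecShift n x i else 0) +
      (fun i => if i ∈ oneSupport (vecShift n x) then
        (((1 : Fin m → SignType) i : SignType) : ℤ) else 0) = vecShift n x := by
    funext i
    have := vecShift_nonneg n hx i
    simp only [Pi.zero_apply] at this
    simp only [Pi.add_apply, mem_oneSupport, Pi.one_apply, SignType.coe_one]
    split_ifs <;> omega
  rw [h, show evalWord (List.replicate n (Letter.t : Letter m)) = HNNExtension.t ^ n by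
    simp [evalWord, Letter.eval]]
  exact evalWord_tailWord hx n

theorem ternaryCost_succ_of_nonneg (K : ℕ) {z : ℤ} (hz : 0 ≤ z) :
    ternaryCost (K + 1) z = ternaryCost K (ternaryQuot z) +
      ((if 2 ≤ z then |(ternaryDigit z : ℤ)| else 0) + if z = 1 then 1 else 0) := by
  obtain rfl | rfl | h : z = 0 ∨ z = 1 ∨ 2 ≤ z := by omega
  · simp [show ternaryQuot 0 = 0 from rfl]
  · simp [show ternaryQuot 1 = 0 from rfl]
  · rw [ternaryCost_succ, coe_ternaryDigit, if_pos h, if_neg (by omega)]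
    ring

theorem length_tailWord {m : ℕ} {x : Fin m → ℤ} (hx : 0 ≤ x) (r K : ℕ) :
    ((tailWord x r).length : ℤ) + ∑ i, ternaryCost K (vecShift r x i) =
      r + ∑ i, ternaryCost (r + K) (x i) := by
  induction r generalizing K with
  | zero => simp [tailWord]
  | succ r ih =>
    have h := ih (K + 1)
    have h₁ : ∀ i, ternaryCost (K + 1) (vecShift r x i) = _ := fun i =>
      ternaryCost_succ_of_nonneg K (vecShift_nonneg r hx i)
    simp only [h₁, ← vecShift_succ_apply, Finset.sum_add_distrib] at h
    rw [tailWord, show r + 1 + K = r + (K + 1) by ring]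
    push_cast [List.length_cons, List.length_append, length_signWord]
    simp only [mem_bigSupport, mem_oneSupport, Pi.one_apply, SignType.coe_one, abs_one]
    linarith

/-- The cap is at most as long as any other way to arrive at the values `2`, `3`, `4`, where one
more letter `t` and one more letter `T` are needed for each further position. For `3` and `4` the
detour through `t` saves two letters; for `2 = 3 - 1` it saves none, so it does not pay if all
values are `2`. -/
theorem length_capWord_le {m : ℕ} {y : Fin m → ℤ} (hy : ∀ i, y i ≤ 4) (K : ℕ) :
    ((capWord y).length : ℤ) ≤ 2 * K + ∑ i, if 2 ≤ y i then ternaryCost K (y i) else 0 := by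
  have h₁ : ∀ K : ℕ, ∀ i, 2 ≤ y i → ternaryCost (K + 1) (y i) = |y i - 3| + 1 := fun K i hi => by
    rw [ternaryCost_succ, ternaryQuot_eq (y := 1), ternaryCost_at_one] <;> have := hy i <;> grind
  rw [capWord]
  split_ifs with h
  · rw [length_square]
    have h₂ : ∑ i, (if i ∈ bigSupport y then (2 : ℤ) else 0) =
        ∑ i, if 2 ≤ y i then ternaryCost K (y i) else 0 := by
      refine Finset.sum_congr rfl fun i _ => ?_
      simp only [mem_bigSupport]
      split_ifs with hi
      · cases K with
        | zero => rw [h i hi]; rfl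
        | succ K => rw [h₁ K i hi, h i hi]; rfl
      · rfl
    omega
  · push_cast [List.length_cons, List.length_append, length_signWord]
    simp only [mem_bigSupport, Pi.one_apply, SignType.coe_one, abs_one]
    have h₂ : ∑ i, (if 2 ≤ y i then (1 : ℤ) else 0) +
        ∑ i, (if 2 ≤ y i then |(ternaryDigit (y i) : ℤ)| else 0) =
        ∑ i, if 2 ≤ y i then |y i - 3| + 1 else 0 := by
      rw [← Finset.sum_add_distrib]
      refine Finset.sum_congr rfl fun i _ => ?_
      split_ifs with hi
      · rw [coe_ternaryDigit_of_le_four hi (hy i)]; ring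
      · rfl
    cases K with
    | succ K =>
      have h₃ : ∑ i, (if 2 ≤ y i then ternaryCost (K + 1) (y i) else 0) =
          ∑ i, if 2 ≤ y i then |y i - 3| + 1 else 0 :=
        Finset.sum_congr rfl fun i _ => by split_ifs with hi; exacts [h₁ K i hi, rfl]
      push_cast
      omega
    | zero =>
      push Not at h
      obtain ⟨j, hj, hj'⟩ := h
      have h₃ : ∑ i, ((if 2 ≤ y i then |y i - 3| + 1 else 0) + if i = j then 2 else 0) ≤
          ∑ i, if 2 ≤ y i then ternaryCost 0 (y i) else 0 := by
        refine Finset.sum_le_sum fun i _ => ?_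
        have := hy i
        simp only [ternaryCost]
        grind
      rw [Finset.sum_add_distrib] at h₃
      simp only [Finset.sum_ite_eq', Finset.mem_univ, if_true] at h₃
      push_cast
      linarith

theorem length_orthantWord_le_of_le {m n : ℕ} {x : Fin m → ℤ} (hx : 0 ≤ x)
    (h₄ : ∀ i, vecShift n x i ≤ 4) (K : ℕ) :
    ((orthantWord n x).length : ℤ) ≤ 2 * (n + K : ℕ) + ∑ i, ternaryCost (n + K) (x i) := by
  have h₁ := length_capWord_le h₄ K
  have h₂ := length_tailWord hx n K
  have h₃ : ∑ i, ternaryCost K (vecShift n x i) =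
      ∑ i, (if 2 ≤ vecShift n x i then ternaryCost K (vecShift n x i) else 0) +
        ∑ i, if vecShift n x i = 1 then 1 else 0 := by
    rw [← Finset.sum_add_distrib]
    refine Finset.sum_congr rfl fun i _ => ?_
    have := vecShift_nonneg n hx i
    simp only [Pi.zero_apply] at this
    obtain h | h | h : vecShift n x i = 0 ∨ vecShift n x i = 1 ∨ 2 ≤ vecShift n x i := by omega
    · simp [h]
    · simp [h]
    · rw [if_pos h, if_neg (by omega), add_zero]
  rw [orthantWord]
  push_cast [List.length_append, List.length_replicate, length_signWord]
  simp only [mem_oneSupport, Pi.one_apply, SignType.coe_one, abs_one]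
  linarith

theorem length_orthantWord_le {m n : ℕ} {x : Fin m → ℤ} (hx : 0 ≤ x)
    (h₂ : ∃ i, 2 ≤ vecShift n x i) (h₄ : ∀ i, vecShift n x i ≤ 4) (M : ℕ) :
    ((orthantWord n x).length : ℤ) ≤ 2 * M + ∑ i, ternaryCost M (x i) := by
  obtain hM | hM := le_total n M
  · obtain ⟨K, rfl⟩ := Nat.exists_eq_add_of_le hM
    exact length_orthantWord_le_of_le hx h₄ K
  · -- Below position `n`, each further position saves the two letters that it costs.
    induction hM using Nat.decreasingInduction with
    | self => exact length_orthantWord_le_of_le hx h₄ 0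
    | of_succ M hM ih =>
      refine ih.trans ?_
      obtain ⟨j, hj⟩ := h₂
      have hj' : 2 ≤ ternaryShift (M + 1) (x j) := by
        obtain ⟨k, hk⟩ := Nat.exists_eq_add_of_le (Nat.succ_le_of_lt hM)
        by_contra hlt
        have h₀ : ∀ k, ternaryShift (M + 1 + k) (x j) ≤ 1 := fun k => by
          induction k with
          | zero => rw [add_zero]; omega
          | succ k ih =>
            have := three_mul_ternaryQuot_le (ternaryShift (M + 1 + k) (x j))
            rw [← add_assoc, ternaryShift_succ]
            omega
        have h₁ := h₀ k
        rw [← Nat.succ_eq_add_one, ← hk] at h₁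
        have : vecShift n x j = ternaryShift n (x j) := rfl
        omega
      have h₃ : ∑ i, (ternaryCost (M + 1) (x i) + if i = j then 2 else 0) ≤
          ∑ i, ternaryCost M (x i) := by
        refine Finset.sum_le_sum fun i _ => ?_
        split_ifs with hi
        · subst hi; exact ternaryCost_succ_add_two_le hj'
        · rw [add_zero]; exact ternaryCost_succ_le M (x i)
      rw [Finset.sum_add_distrib] at h₃
      simp only [Finset.sum_ite_eq', Finset.mem_univ, if_true] at h₃
      push_cast
      linarith

/-! ### Words of the language are words of vectors -/

/-- The words have the same length and spell the same element, and are equal if `S` holds. -/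
def WordEquiv {m : ℕ} (S : Prop) (w w' : List (Letter m)) : Prop :=
  evalWord w = evalWord w' ∧ w.length = w'.length ∧ (S → w = w')

theorem WordEquiv.append_left {m : ℕ} {S : Prop} {w w' : List (Letter m)} (u : List (Letter m))
    (h : WordEquiv S w w') : WordEquiv S (u ++ w) (u ++ w') :=
  ⟨by simp [h.1], by simp [h.2.1], fun hS => by rw [h.2.2 hS]⟩

theorem WordEquiv.mono {m : ℕ} {S S' : Prop} {w w' : List (Letter m)} (hS : S' → S)
    (h : WordEquiv S w w') : WordEquiv S' w w' :=
  ⟨h.1, h.2.1, fun h' => h.2.2 (hS h')⟩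

theorem sdiff_univ_eq_empty {m : ℕ} (Z : Finset (Fin m)) : Z \ Finset.univ = ∅ := by simp

theorem mem_langU {m : ℕ} {X : Finset (Fin m)} {w : List (Letter m)} :
    w ∈ langU X ↔ w = signWord X 1 := by
  rw [signWord_one]; rfl

theorem mem_langUinv {m : ℕ} {X : Finset (Fin m)} {w : List (Letter m)} :
    w ∈ langUinv X ↔ w = signWord X (-1) := by
  rw [signWord_neg_one]; rfl

theorem mem_langW {m : ℕ} {X : Finset (Fin m)} {w : List (Letter m)} :
    w ∈ langW X ↔ ∃ e, w = signWord X e := Iff.rfl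

theorem mem_langt {m : ℕ} {w : List (Letter m)} : w ∈ langt m ↔ w = [Letter.t] := Iff.rfl

theorem mem_langT {m : ℕ} {w : List (Letter m)} : w ∈ langT m ↔ w = [Letter.T] := Iff.rfl

theorem mem_langt_pow {m n : ℕ} {w : List (Letter m)} :
    w ∈ langt m ^ n ↔ w = List.replicate n Letter.t := by
  induction n generalizing w with
  | zero => simp
  | succ n ih =>
    rw [pow_succ', Language.mem_mul]
    simp only [mem_langt, ih]
    simp [List.replicate_succ, eq_comm]

theorem mem_langT_mul_langW_mul {m : ℕ} {X : Finset (Fin m)} {L : Language (Letter m)}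
    {w : List (Letter m)} : w ∈ langT m * langW X * L ↔
      ∃ e, ∃ v ∈ L, w = Letter.T :: (signWord X e ++ v) := by
  simp only [Language.mem_mul, mem_langT, mem_langW]
  constructor
  · rintro ⟨_, ⟨_, rfl, _, ⟨e, rfl⟩, rfl⟩, v, hv, rfl⟩
    exact ⟨e, v, hv, rfl⟩
  · rintro ⟨e, v, hv, rfl⟩
    exact ⟨_, ⟨_, rfl, _, ⟨e, rfl⟩, rfl⟩, v, hv, rfl⟩

theorem mem_langU_mul {m : ℕ} {X : Finset (Fin m)} {L : Language (Letter m)}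
    {w : List (Letter m)} : w ∈ langU X * L ↔ ∃ v ∈ L, w = signWord X 1 ++ v := by
  simp [Language.mem_mul, mem_langU, eq_comm]

theorem mem_block {m : ℕ} {φ : Equiv.Perm (Fin m)} {s i : ℕ} {j : Fin m} :
    j ∈ block φ s i ↔ s ≤ (φ.symm j : ℕ) ∧ (φ.symm j : ℕ) < s + i := by
  simp [block, Finset.mem_map_equiv]

theorem wordEquiv_signWord_union {m : ℕ} {X Z : Finset (Fin m)} (h : Disjoint X Z)
    (w : List (Letter m)) :
    WordEquiv (Z = ∅) (signWord X 1 ++ (signWord Z 1 ++ w)) (signWord (X ∪ Z) 1 ++ w) := by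
  have hd : ∀ i, i ∈ X → i ∉ Z := fun i hi => Finset.disjoint_left.1 h hi
  refine ⟨?_, ?_, fun hZ => by simp [hZ]⟩
  · simp only [evalWord_append, evalWord_signWord]
    rw [← mul_assoc, ← horocyclic_add]
    congr 2
    funext i
    have := hd i
    by_cases h₁ : i ∈ X <;> by_cases h₂ : i ∈ Z <;> simp_all
  · have h₁ : ((signWord X 1).length : ℤ) + (signWord Z 1).length =
        (signWord (X ∪ Z) 1).length := by
      rw [length_signWord, length_signWord, length_signWord, ← Finset.sum_add_distrib]
      refine Finset.sum_congr rfl fun i _ => ?_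
      have := hd i
      by_cases h₁ : i ∈ X <;> by_cases h₂ : i ∈ Z <;> simp_all
    simp only [List.length_append]
    omega

/-- Every word of `L`, read from a vector `y` with support `Y` and with `r` letters `T` to go,
is, up to the order of adjacent letters `aᵢ`, the tail of the word of a positive vector `x`. The
letters at the beginning of the word start the expansions of the coordinates outside `Y` that have
their leading digit at position `r`. -/
def IsTailFrom {m : ℕ} (S : Prop) (L : Language (Letter m)) (Y : Finset (Fin m)) (r : ℕ) : Prop :=
  ∀ w ∈ L, ∀ y : Fin m → ℤ, 0 ≤ y → posSupport y = Y → ∃ x : Fin m → ℤ, (∀ i, 0 < x i) ∧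
    (∀ i ∈ Y, vecShift r x i = y i) ∧ (∀ i ∉ Y, vecShift r x i ≤ 1) ∧
    WordEquiv S w (signWord (oneSupport (vecShift r x) \ Y) 1 ++ tailWord x r)

/-- The variant of `IsTailFrom` in which no expansion begins at position `r`. -/
def IsTailFromT {m : ℕ} (S : Prop) (L : Language (Letter m)) (Y : Finset (Fin m)) (r : ℕ) : Prop :=
  ∀ w ∈ L, ∀ y : Fin m → ℤ, 0 ≤ y → posSupport y = Y → ∃ x : Fin m → ℤ, (∀ i, 0 < x i) ∧
    vecShift r x = y ∧ WordEquiv S w (tailWord x r)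

theorem IsTailFromT.isTailFrom {m : ℕ} {S : Prop} {L : Language (Letter m)} {Y : Finset (Fin m)}
    {r : ℕ} (h : IsTailFromT S L Y r) : IsTailFrom S L Y r := by
  intro w hw y hy hY
  obtain ⟨x, hx, hxy, hwx⟩ := h w hw y hy hY
  refine ⟨x, hx, fun i _ => by rw [hxy], fun i hi => ?_, ?_⟩
  · rw [← hY, mem_posSupport] at hi
    rw [hxy]; omega
  · have : oneSupport (vecShift r x) \ Y = ∅ := by
      rw [Finset.sdiff_eq_empty_iff_subset]
      intro i hi
      rw [hxy, mem_oneSupport] at hi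
      rw [← hY, mem_posSupport, hi]
      exact one_pos
    rw [this, signWord_empty]
    exact hwx

theorem IsTailFrom.T_mul_W_mul {m : ℕ} {S : Prop} {L : Language (Letter m)} {Y : Finset (Fin m)}
    {r : ℕ} (h : IsTailFrom S L Y r) : IsTailFromT S (langT m * langW Y * L) Y (r + 1) := by
  intro w hw y hy hY
  obtain ⟨e, v, hv, rfl⟩ := mem_langT_mul_langW_mul.1 hw
  have hmem : ∀ i, i ∈ Y ↔ 0 < y i := fun i => by rw [← hY, mem_posSupport]
  have hy' : ∀ i, 0 ≤ y i := hy
  let y' : Fin m → ℤ := fun i => if i ∈ Y then 3 * y i + e i else 0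
  have hy'Y : ∀ i, i ∈ Y → y' i = 3 * y i + e i := fun i hi => if_pos hi
  have hy'2 : ∀ i, i ∈ Y → 2 ≤ y' i := fun i hi => by
    rw [hy'Y i hi]
    have := (hmem i).1 hi
    have := signType_coe_cases (e i)
    omega
  have hy'n : ∀ i, i ∉ Y → y' i = 0 := fun i hi => if_neg hi
  obtain ⟨x, hx, hxY, hxn, hwx⟩ := h v hv y' (fun i => by
      by_cases hi : i ∈ Y
      · exact zero_le_two.trans (hy'2 i hi)
      · exact (hy'n i hi).ge) (by
      ext i
      rw [mem_posSupport]
      by_cases hi : i ∈ Y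
      · have := hy'2 i hi
        exact iff_of_true (by omega) hi
      · exact iff_of_false (by rw [hy'n i hi]; simp) hi)
  have hx0 : ∀ i, 0 ≤ vecShift r x i := vecShift_nonneg r fun i => (hx i).le
  refine ⟨x, hx, ?_, ?_⟩
  · funext i
    rw [vecShift_succ_apply]
    by_cases hi : i ∈ Y
    · rw [hxY i hi, hy'Y i hi, ternaryQuot_add_sign]
    · have h₁ := hxn i hi
      have h₂ := hx0 i
      have h₃ := hy' i
      rw [hmem] at hi
      apply ternaryQuot_eq <;> omega
  · have hbig : bigSupport (vecShift r x) = Y := by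
      ext i
      rw [mem_bigSupport]
      by_cases hi : i ∈ Y
      · rw [hxY i hi]
        exact iff_of_true (hy'2 i hi) hi
      · have := hxn i hi
        exact iff_of_false (by omega) hi
    have hone : oneSupport (vecShift r x) \ Y = oneSupport (vecShift r x) := by
      rw [Finset.sdiff_eq_self_iff_disjoint, Finset.disjoint_left]
      intro i hi hiY
      rw [mem_oneSupport, hxY i hiY] at hi
      have := hy'2 i hiY
      omega
    have hdig : signWord Y (fun i => ternaryDigit (vecShift r x i)) = signWord Y e :=
      signWord_congr fun i hi => by rw [hxY i hi, hy'Y i hi, ternaryDigit_add_sign]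
    rw [tailWord, hbig, hdig]
    rw [hone] at hwx
    exact hwx.append_left (Letter.T :: signWord Y e)

theorem IsTailFrom.pow_mul {m : ℕ} {S : Prop} {L : Language (Letter m)} {Y : Finset (Fin m)}
    {r : ℕ} (h : IsTailFrom S L Y r) (j : ℕ) :
    IsTailFromT S ((langT m * langW Y) ^ (j + 1) * L) Y (j + 1 + r) := by
  induction j with
  | zero =>
    rw [zero_add, pow_one, add_comm]
    exact h.T_mul_W_mul
  | succ j ih =>
    rw [pow_succ', mul_assoc, show j + 1 + 1 + r = j + 1 + r + 1 by ring]
    exact ih.isTailFrom.T_mul_W_mul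

theorem isTailFrom_langTail {m : ℕ} (φ : Equiv.Perm (Fin m)) (P : List (ℕ × ℕ)) (s : ℕ)
    (hm : s + (P.map Prod.fst).sum = m) :
    IsTailFrom (∀ p ∈ P.dropLast, 0 < p.2) (langTail φ s P) (block φ 0 s)
      (P.map Prod.snd).sum := by
  have huniv : ∀ s, s = m → block φ 0 s = Finset.univ := fun s hs => by
    ext j
    have := (φ.symm j).isLt
    simp only [mem_block, Finset.mem_univ, iff_true]
    omega
  induction P generalizing s with
  | nil =>
    intro w hw y hy hY
    rw [langTail, Language.mem_one] at hw
    simp only [List.map_nil, List.sum_nil, add_zero] at hm ⊢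
    rw [huniv s hm] at hY ⊢
    refine ⟨y, fun i => ?_, fun i _ => rfl, fun i hi => absurd (Finset.mem_univ i) hi, ?_⟩
    · rw [← mem_posSupport, hY]
      exact Finset.mem_univ i
    · rw [sdiff_univ_eq_empty, signWord_empty]
      rw [hw]
      exact ⟨rfl, rfl, fun _ => rfl⟩
  | cons p P ih =>
    obtain ⟨i, j⟩ := p
    simp only [List.map_cons, List.sum_cons] at hm ⊢
    have ih := ih (s + i) (by omega)
    intro w hw y hy hY
    rw [langTail, mul_assoc, mem_langU_mul] at hw
    obtain ⟨v, hv, rfl⟩ := hw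
    have hmem : ∀ k, k ∈ block φ 0 s ↔ 0 < y k := fun k => by rw [← hY, mem_posSupport]
    have hy0 : ∀ k, 0 ≤ y k := hy
    have hdisj : ∀ k, k ∈ block φ s i → k ∉ block φ 0 s := fun k => by
      simp only [mem_block]; omega
    have hunion : ∀ k, k ∈ block φ 0 (s + i) ↔ k ∈ block φ 0 s ∨ k ∈ block φ s i := fun k => by
      simp only [mem_block]; omega
    let y' : Fin m → ℤ := fun k => if k ∈ block φ s i then 1 else y k
    have hy'1 : ∀ k, k ∈ block φ s i → y' k = 1 := fun k hk => if_pos hk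
    have hy'n : ∀ k, k ∉ block φ s i → y' k = y k := fun k hk => if_neg hk
    have hy' : 0 ≤ y' := fun k => by
      by_cases hk : k ∈ block φ s i
      · rw [hy'1 k hk]; exact zero_le_one
      · rw [hy'n k hk]; exact hy0 k
    have hsupp : posSupport y' = block φ 0 (s + i) := by
      ext k
      rw [mem_posSupport, hunion, hmem]
      by_cases hk : k ∈ block φ s i
      · simp [hy'1 k hk, hk]
      · simp [hy'n k hk, hk]
    cases j with
    | zero =>
      rw [pow_zero, one_mul] at hv
      obtain ⟨x, hx, hxY, hxn, hvx⟩ := ih v hv y' hy' hsupp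
      rw [zero_add]
      set r := (P.map Prod.snd).sum
      have hxblock : ∀ k ∈ block φ s i, vecShift r x k = 1 := fun k hk => by
        rw [hxY k ((hunion k).2 (Or.inr hk)), hy'1 k hk]
      refine ⟨x, hx, fun k hk => ?_, fun k hk => ?_, ?_⟩
      · rw [hxY k ((hunion k).2 (Or.inl hk)), hy'n k fun h => hdisj k h hk]
      · by_cases hk' : k ∈ block φ s i
        · exact (hxblock k hk').le
        · exact hxn k fun h => ((hunion k).1 h).elim hk hk'
      · have hone : oneSupport (vecShift r x) \ block φ 0 s =
            block φ s i ∪ oneSupport (vecShift r x) \ block φ 0 (s + i) := by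
          ext k
          have := hxblock k
          have := hdisj k
          simp only [Finset.mem_sdiff, Finset.mem_union, hunion, mem_oneSupport]
          tauto
        have h₁ := hvx.append_left (signWord (block φ s i) 1)
        have h₂ := wordEquiv_signWord_union (X := block φ s i)
          (Z := oneSupport (vecShift r x) \ block φ 0 (s + i)) (by
            rw [Finset.disjoint_left]
            intro k hk hk'
            exact (Finset.mem_sdiff.1 hk').2 ((hunion k).2 (Or.inr hk))) (tailWord x r)
        rw [← hone] at h₂
        refine ⟨h₁.1.trans h₂.1, h₁.2.1.trans h₂.2.1, fun hS => ?_⟩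
        -- Only a last pair may have `j = 0`, and after it no coordinate is left.
        cases P with
        | nil =>
          have hu := huniv (s + i) (by simpa using hm)
          refine (h₁.2.2 (by simp)).trans (h₂.2.2 ?_)
          rw [hu, sdiff_univ_eq_empty]
        | cons q P => exact absurd (hS (i, 0) (by simp)) (by simp)
    | succ j =>
      obtain ⟨x, hx, hxy, hvx⟩ := ih.pow_mul j v hv y' hy' hsupp
      set r := j + 1 + (P.map Prod.snd).sum
      refine ⟨x, hx, fun k hk => ?_, fun k hk => ?_, ?_⟩
      · rw [hxy, hy'n k fun h => hdisj k h hk]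
      · rw [hxy]
        by_cases hk' : k ∈ block φ s i
        · exact (hy'1 k hk').le
        · rw [hy'n k hk']
          rw [hmem] at hk
          omega
      · have hone : oneSupport (vecShift r x) \ block φ 0 s = block φ s i := by
          ext k
          rw [Finset.mem_sdiff, mem_oneSupport, hxy, hmem]
          by_cases hk : k ∈ block φ s i
          · have h₁ := hdisj k hk
            rw [hmem] at h₁
            exact iff_of_true ⟨hy'1 k hk, h₁⟩ hk
          · rw [hy'n k hk]
            exact iff_of_false (by omega) hk
        rw [hone]
        refine (hvx.append_left _).mono fun hS p hp => ?_
        cases P with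
        | nil => simp at hp
        | cons q P => exact hS p (by rw [List.dropLast_cons_cons]; exact List.mem_cons_of_mem _ hp)

theorem capWord_congr {m : ℕ} {y z : Fin m → ℤ} (hs : bigSupport y = bigSupport z)
    (h : ∀ i ∈ bigSupport y, y i = z i) : capWord y = capWord z := by
  have h₁ : (∀ i, 2 ≤ y i → y i = 2) ↔ ∀ i, 2 ≤ z i → z i = 2 := by
    refine forall_congr' fun i => ?_
    rw [← mem_bigSupport, ← mem_bigSupport, ← hs]
    refine forall_congr' fun hi => ?_
    rw [h i hi]
  have h₂ : signWord (bigSupport y) (fun i => ternaryDigit (y i)) =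
      signWord (bigSupport y) fun i => ternaryDigit (z i) :=
    signWord_congr fun i hi => by rw [h i hi]
  rw [capWord, capWord, h₂, hs]
  simp only [h₁]

theorem mem_capWithTail {m : ℕ} {X : Finset (Fin m)} {L : Language (Letter m)}
    {w : List (Letter m)} : w ∈ langt m * langU X * langT m * L ↔
      ∃ v ∈ L, w = Letter.t :: (signWord X 1 ++ (Letter.T :: v)) := by
  simp only [Language.mem_mul, mem_langT, mem_langt, mem_langU]
  constructor
  · rintro ⟨_, ⟨_, ⟨_, rfl, _, rfl, rfl⟩, _, rfl, rfl⟩, v, hv, rfl⟩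
    exact ⟨v, hv, by simp⟩
  · rintro ⟨v, hv, rfl⟩
    exact ⟨_, ⟨_, ⟨_, rfl, _, rfl, rfl⟩, _, rfl, rfl⟩, v, hv, by simp⟩

/-- The caps are the words `capWord y`, where the coordinates of `y` are in `{2, 3, 4}` on `X` and
vanish outside `X`. -/
theorem exists_capWord_eq {m : ℕ} {X : Finset (Fin m)} {v : List (Letter m)} (hv : v ∈ langV X) :
    ∃ y : Fin m → ℤ, 0 ≤ y ∧ posSupport y = X ∧ bigSupport y = X ∧ (∀ i, y i ≤ 4) ∧
      v = capWord y := by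
  obtain ⟨hv | hv, hn⟩ := hv
  · have hv' : v = (X.sort (· ≤ ·)).flatMap fun i => [Letter.a i, Letter.a i] := hv
    have hb : bigSupport (fun i => if i ∈ X then (2 : ℤ) else 0) = X := by
      ext i; by_cases hi : i ∈ X <;> simp [hi]
    refine ⟨fun i => if i ∈ X then 2 else 0, fun i => ?_, ?_, hb, fun i => ?_, ?_⟩
    · dsimp only [Pi.zero_apply]; split_ifs <;> norm_num
    · ext i; by_cases hi : i ∈ X <;> simp [hi]
    · dsimp only; split_ifs <;> norm_num
    · rw [capWord, if_pos, hb, hv']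
      intro i; split_ifs <;> simp
  · obtain ⟨_, ⟨e, rfl⟩, rfl⟩ := mem_capWithTail.1 hv
    let y : Fin m → ℤ := fun i => if i ∈ X then 3 * 1 + (e i : ℤ) else 0
    have hyX : ∀ i, i ∈ X → y i = 3 * 1 + (e i : ℤ) := fun i hi => if_pos hi
    have hyn : ∀ i, i ∉ X → y i = 0 := fun i hi => if_neg hi
    have hb : bigSupport y = X := by
      ext i
      rw [mem_bigSupport]
      have := signType_coe_cases (e i)
      by_cases hi : i ∈ X
      · rw [hyX i hi]; simp only [hi, iff_true]; omega
      · rw [hyn i hi]; simp [hi]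
    have hbound : ∀ i, 0 ≤ y i ∧ y i ≤ 4 ∧ (0 < y i ↔ 2 ≤ y i) := fun i => by
      have := signType_coe_cases (e i)
      by_cases hi : i ∈ X
      · rw [hyX i hi]; omega
      · rw [hyn i hi]; simp
    refine ⟨y, fun i => (hbound i).1, ?_, hb, fun i => (hbound i).2.1, ?_⟩
    · rw [← hb]; ext i; rw [mem_posSupport, mem_bigSupport, (hbound i).2.2]
    · rw [capWord, hb, if_neg, signWord_congr (e := fun i => ternaryDigit (y i)) (f := e)]
      · rfl
      · intro i hi; rw [hyX i hi, ternaryDigit_add_sign]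
      · intro hall
        refine hn (mem_capWithTail.2 ⟨_, mem_langUinv.2 (signWord_congr fun i hi => ?_), rfl⟩)
        have h₁ := hall i (by rw [← mem_bigSupport, hb]; exact hi)
        rw [hyX i hi] at h₁
        apply signType_coe_injective
        simp
        omega

theorem exists_wordEquiv_orthantWord {m n : ℕ} {φ : Equiv.Perm (Fin m)} {p : ℕ × ℕ}
    {P : List (ℕ × ℕ)} (hP : IsPairPartition m n (p :: P)) {w : List (Letter m)}
    (hw : w ∈ langPiece n φ p P) :
    ∃ x : Fin m → ℤ, (∀ i, 0 < x i) ∧ (∃ i, 2 ≤ vecShift n x i) ∧ (∀ i, vecShift n x i ≤ 4) ∧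
      WordEquiv (∀ q ∈ P.dropLast, 0 < q.2) w (orthantWord n x) := by
  obtain ⟨i, j⟩ := p
  obtain ⟨hpos, hfst, hsnd⟩ := hP
  simp only [List.map_cons, List.sum_cons] at hfst hsnd
  have hi : 0 < i := hpos (i, j) (by simp)
  simp only [langPiece, mul_assoc (langt m ^ n), mul_assoc (langV _)] at hw
  obtain ⟨_, ht, _, ⟨v, hv, u, hu, rfl⟩, rfl⟩ := hw
  obtain rfl := mem_langt_pow.1 ht
  obtain ⟨y, hy, hsupp, hbig, hy4, rfl⟩ := exists_capWord_eq hv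
  have htail := isTailFrom_langTail φ P i hfst
  have hne : φ ⟨0, by omega⟩ ∈ block φ 0 i := by
    rw [mem_block]; simpa using hi
  have hblock : ∀ k, k ∈ block φ 0 i ↔ 2 ≤ y k := fun k => by rw [← hbig, mem_bigSupport]
  have key : ∃ x : Fin m → ℤ, (∀ i, 0 < x i) ∧ (∀ k ∈ block φ 0 i, vecShift n x k = y k) ∧
      (∀ k ∉ block φ 0 i, vecShift n x k ≤ 1) ∧ WordEquiv (∀ q ∈ P.dropLast, 0 < q.2) u
        (signWord (oneSupport (vecShift n x) \ block φ 0 i) 1 ++ tailWord x n) := by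
    cases j with
    | zero =>
      rw [pow_zero, one_mul] at hu
      rw [zero_add] at hsnd
      rw [← hsnd]
      exact htail u hu y hy hsupp
    | succ j =>
      rw [← hsnd]
      exact (htail.pow_mul j).isTailFrom u hu y hy hsupp
  obtain ⟨x, hx, hxy, hxn, hux⟩ := key
  have hbig' : bigSupport (vecShift n x) = block φ 0 i := by
    ext k
    rw [mem_bigSupport]
    by_cases hk : k ∈ block φ 0 i
    · rw [hxy k hk]
      exact iff_of_true ((hblock k).1 hk) hk
    · have := hxn k hk
      exact iff_of_false (by omega) hk
  have hone : oneSupport (vecShift n x) \ block φ 0 i = oneSupport (vecShift n x) := by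
    rw [Finset.sdiff_eq_self_iff_disjoint, Finset.disjoint_left]
    intro k hk hk'
    rw [← hbig', mem_bigSupport] at hk'
    rw [mem_oneSupport] at hk
    omega
  refine ⟨x, hx, ⟨_, mem_bigSupport.1 (hbig'.symm ▸ hne)⟩, fun k => ?_, ?_⟩
  · by_cases hk : k ∈ block φ 0 i
    · rw [hxy k hk]; exact hy4 k
    · exact (hxn k hk).trans (by norm_num)
  · rw [hone] at hux
    rw [orthantWord, capWord_congr (z := y) (hbig'.trans hbig.symm) fun k hk =>
      hxy k (hbig' ▸ hk)]
    exact (hux.append_left _).append_left _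

/-! ### The word of a vector is in the language -/

theorem mem_iff_lt_card_of_lower {m : ℕ} {D : Finset (Fin m)} (hD : ∀ a b, a ≤ b → b ∈ D → a ∈ D)
    (k : Fin m) : k ∈ D ↔ (k : ℕ) < D.card := by
  constructor
  · intro hk
    have h := Finset.card_le_card (show Finset.Iic k ⊆ D from fun a ha =>
      hD a k (Finset.mem_Iic.1 ha) hk)
    rw [Fin.card_Iic] at h
    omega
  · intro hk
    by_contra hn
    have h := Finset.card_le_card (show D ⊆ Finset.Iio k from fun a ha =>
      Finset.mem_Iio.2 (lt_of_not_ge fun hka => hn (hD k a hka ha)))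
    rw [Fin.card_Iio] at h
    omega

theorem block_card_eq {m : ℕ} {φ : Equiv.Perm (Fin m)} {S : Finset (Fin m)}
    (hS : ∀ a b, a ≤ b → φ b ∈ S → φ a ∈ S) : block φ 0 S.card = S := by
  ext j
  have h := mem_iff_lt_card_of_lower (D := S.map φ.symm.toEmbedding) (by
    intro a b hab hb
    rw [Finset.mem_map_equiv, Equiv.symm_symm] at hb ⊢
    exact hS a b hab hb) (φ.symm j)
  rw [Finset.card_map, Finset.mem_map_equiv, Equiv.symm_symm, Equiv.apply_symm_apply] at h
  rw [mem_block, h]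
  simp

/-- The permutation `φ` lists the coordinates of `x` by decreasing position of their leading digit:
for each `r`, the coordinates with leading digit at position `r` or higher come first. -/
def OrdersByLeadingDigit {m : ℕ} (φ : Equiv.Perm (Fin m)) (x : Fin m → ℤ) : Prop :=
  ∀ r, block φ 0 (posSupport (vecShift r x)).card = posSupport (vecShift r x)

theorem exists_ordersByLeadingDigit {m : ℕ} (x : Fin m → ℤ) :
    ∃ φ : Equiv.Perm (Fin m), OrdersByLeadingDigit φ x := by
  refine ⟨Tuple.sort fun i => -x i, fun r => block_card_eq fun a b hab hb => ?_⟩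
  have h := Tuple.monotone_sort (fun i => -x i) hab
  simp only [Function.comp_apply, neg_le_neg_iff] at h
  rw [mem_posSupport] at hb ⊢
  exact hb.trans_le (ternaryShift_mono r h)

theorem card_posSupport_vecShift_succ_le {m : ℕ} (r : ℕ) (x : Fin m → ℤ) :
    (posSupport (vecShift (r + 1) x)).card ≤ (posSupport (vecShift r x)).card := by
  rw [posSupport_vecShift_succ]
  refine Finset.card_le_card fun i hi => ?_
  rw [mem_bigSupport] at hi
  rw [mem_posSupport]
  omega

theorem OrdersByLeadingDigit.block_eq_oneSupport {m : ℕ} {φ : Equiv.Perm (Fin m)} {x : Fin m → ℤ}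
    (h : OrdersByLeadingDigit φ x) (r : ℕ) :
    block φ (posSupport (vecShift (r + 1) x)).card
      ((posSupport (vecShift r x)).card - (posSupport (vecShift (r + 1) x)).card) =
        oneSupport (vecShift r x) := by
  ext j
  have h₀ := Finset.ext_iff.1 (h r) j
  have h₁ := Finset.ext_iff.1 (h (r + 1)) j
  have hle := card_posSupport_vecShift_succ_le r x
  rw [posSupport_vecShift_succ, mem_bigSupport, ← posSupport_vecShift_succ] at h₁
  rw [mem_posSupport] at h₀
  rw [mem_block] at h₀ h₁ ⊢
  rw [mem_oneSupport]
  omega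

/-- The partition of the tail is built from position `0` upwards. A new pair is begun at each
position at which some expansion begins, so that all but the last pair have a positive second
entry. -/
theorem tailWord_mem {m : ℕ} {φ : Equiv.Perm (Fin m)} {x : Fin m → ℤ}
    (h : OrdersByLeadingDigit φ x) (hx : ∀ i, 0 < x i) (r : ℕ) :
    ∃ (k : ℕ) (P : List (ℕ × ℕ)),
      tailWord x r ∈ (langT m * langW (posSupport (vecShift r x))) ^ k *
        langTail φ (posSupport (vecShift r x)).card P ∧
      (∀ p ∈ P, 0 < p.1) ∧ (posSupport (vecShift r x)).card + (P.map Prod.fst).sum = m ∧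
      k + (P.map Prod.snd).sum = r ∧ (∀ p ∈ P.dropLast, 0 < p.2) ∧ (P ≠ [] → 0 < k) := by
  induction r with
  | zero =>
    refine ⟨0, [], ?_, by simp, ?_, by simp, by simp, by simp⟩
    · simp [tailWord, langTail]
    · have : posSupport (vecShift 0 x) = Finset.univ := by
        ext i; simpa using hx i
      rw [this]; simp
  | succ r ih =>
    obtain ⟨k, P, hmem, hpos, hfst, hsnd, hdrop, hk⟩ := ih
    have hle := card_posSupport_vecShift_succ_le r x
    have hsub := posSupport_vecShift_succ r x
    obtain heq | hlt := hle.eq_or_lt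
    · refine ⟨k + 1, P, ?_, hpos, by omega, by omega, hdrop, fun _ => by omega⟩
      have hone := h.block_eq_oneSupport r
      rw [heq, Nat.sub_self] at hone
      have hempty : oneSupport (vecShift r x) = ∅ := by
        rw [← hone]
        ext j
        rw [mem_block]
        simp
      have hpp : posSupport (vecShift (r + 1) x) = posSupport (vecShift r x) := by
        rw [← h r, ← h (r + 1), heq]
      rw [tailWord, hempty, signWord_empty, List.nil_append, ← hsub, pow_succ', mul_assoc,
        mem_langT_mul_langW_mul, hpp]
      exact ⟨_, _, hmem, rfl⟩
    · refine ⟨1, ((posSupport (vecShift r x)).card - (posSupport (vecShift (r + 1) x)).card, k) :: P,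
        ?_, ?_, ?_, ?_, ?_, fun _ => one_pos⟩
      · rw [tailWord, ← hsub, pow_one, mem_langT_mul_langW_mul]
        refine ⟨_, _, ?_, rfl⟩
        rw [langTail, mul_assoc, mem_langU_mul, h.block_eq_oneSupport, Nat.add_sub_cancel' hle, h r]
        exact ⟨_, hmem, rfl⟩
      · intro p hp
        obtain rfl | hp := List.mem_cons.1 hp
        · exact Nat.sub_pos_of_lt hlt
        · exact hpos p hp
      · simp only [List.map_cons, List.sum_cons]
        omega
      · simp only [List.map_cons, List.sum_cons]
        omega
      · cases P with
        | nil => simp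
        | cons q P =>
          intro p hp
          rw [List.dropLast_cons_cons] at hp
          obtain rfl | hp := List.mem_cons.1 hp
          · exact hk (by simp)
          · exact hdrop p hp

theorem capWord_mem_langV {m : ℕ} {y : Fin m → ℤ} (hy : ∀ i, y i ≤ 4) :
    capWord y ∈ langV (bigSupport y) := by
  by_cases h : ∀ i, 2 ≤ y i → y i = 2
  · rw [capWord, if_pos h]
    refine ⟨Or.inl rfl, fun hmem => ?_⟩
    obtain ⟨v, -, hv⟩ := mem_capWithTail.1 hmem
    have ht : Letter.t ∈ ((bigSupport y).sort (· ≤ ·)).flatMap fun i =>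
        [Letter.a i, Letter.a i] := hv ▸ List.mem_cons_self
    simp at ht
  · rw [capWord, if_neg h]
    refine ⟨Or.inr (mem_capWithTail.2 ⟨_, ⟨_, rfl⟩, rfl⟩), fun hmem => h ?_⟩
    obtain ⟨v, hv, heq⟩ := mem_capWithTail.1 hmem
    rw [mem_langUinv.1 hv] at heq
    simp only [List.cons.injEq, true_and, List.append_cancel_left_eq] at heq
    have he := congrArg evalWord heq
    rw [evalWord_signWord, evalWord_signWord] at he
    intro i hi
    have hd := congrFun (horocyclic_injective he) i
    simp only [mem_bigSupport, hi, if_true, coe_ternaryDigit_of_le_four hi (hy i)] at hd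
    simp at hd
    omega

theorem orthantWord_mem_normalLanguage {m n : ℕ} {x : Fin m → ℤ} (hx : ∀ i, 0 < x i)
    (h₂ : ∃ i, 2 ≤ vecShift n x i) (h₄ : ∀ i, vecShift n x i ≤ 4) :
    orthantWord n x ∈ normalLanguage m := by
  obtain ⟨φ, hφ⟩ := exists_ordersByLeadingDigit x
  obtain ⟨k, P, hmem, hpos, hfst, hsnd, hdrop, hk⟩ := tailWord_mem hφ hx n
  have hle := card_posSupport_vecShift_succ_le n x
  have hsub := posSupport_vecShift_succ n x
  have hne : 0 < (posSupport (vecShift (n + 1) x)).card := by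
    obtain ⟨i, hi⟩ := h₂
    exact Finset.card_pos.2 ⟨i, by rw [hsub, mem_bigSupport]; exact hi⟩
  have hcap := capWord_mem_langV h₄
  rw [← hsub, ← hφ (n + 1)] at hcap
  right
  obtain heq | hlt := hle.eq_or_lt
  · refine ⟨n, φ, ((posSupport (vecShift (n + 1) x)).card, k), P, ⟨?_, ?_, ?_⟩, hdrop, ?_⟩
    · intro p hp
      obtain rfl | hp := List.mem_cons.1 hp
      exacts [hne, hpos p hp]
    · simp only [List.map_cons, List.sum_cons]; omega
    · simpa using hsnd
    · have hone := hφ.block_eq_oneSupport n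
      rw [heq, Nat.sub_self] at hone
      have hempty : oneSupport (vecShift n x) = ∅ := by
        rw [← hone]
        ext j
        rw [mem_block]
        simp
      rw [langPiece, mul_assoc, mul_assoc]
      refine ⟨_, mem_langt_pow.2 rfl, _, ⟨_, hcap, _, ?_, rfl⟩, rfl⟩
      rw [hempty, signWord_empty, List.nil_append]
      dsimp only
      rw [heq, hφ n]
      exact hmem
  · refine ⟨n, φ, ((posSupport (vecShift (n + 1) x)).card, 0),
      ((posSupport (vecShift n x)).card - (posSupport (vecShift (n + 1) x)).card, k) :: P,
      ⟨?_, ?_, ?_⟩, ?_, ?_⟩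
    · intro p hp
      simp only [List.mem_cons] at hp
      obtain rfl | rfl | hp := hp
      exacts [hne, Nat.sub_pos_of_lt hlt, hpos p hp]
    · simp only [List.map_cons, List.sum_cons]; omega
    · simpa using hsnd
    · cases P with
      | nil => simp
      | cons q P =>
        intro p hp
        rw [List.dropLast_cons_cons] at hp
        obtain rfl | hp := List.mem_cons.1 hp
        · exact hk (by simp)
        · exact hdrop p hp
    · rw [langPiece, mul_assoc, mul_assoc]
      refine ⟨_, mem_langt_pow.2 rfl, _, ⟨_, hcap, _, ?_, rfl⟩, rfl⟩
      dsimp only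
      rw [pow_zero, one_mul, langTail, mul_assoc, hφ.block_eq_oneSupport,
        Nat.add_sub_cancel' hle, hφ n]
      exact mem_langU_mul.2 ⟨_, hmem, rfl⟩

/-! ### The language and the positive orthant -/

theorem ternaryShift_le (n : ℕ) (x : ℤ) : ternaryShift n x ≤ 4 ∨ ternaryShift n x + n ≤ x := by
  induction n with
  | zero => simp
  | succ n ih =>
    have := three_mul_ternaryQuot_le (ternaryShift n x)
    rw [ternaryShift_succ]
    push_cast
    omega

theorem exists_vecShift_le_four {m : ℕ} {x : Fin m → ℤ} (hx : ∀ i, 0 < x i) (hx1 : x ≠ 1) :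
    ∃ n, (∃ i, 2 ≤ vecShift n x i) ∧ ∀ i, vecShift n x i ≤ 4 := by
  have hex : ∃ n, ∀ i, vecShift n x i ≤ 4 := by
    refine ⟨(∑ i, x i).toNat, fun i => ?_⟩
    have h₁ := Finset.single_le_sum (f := x) (fun j _ => (hx j).le) (Finset.mem_univ i)
    have h₂ := ternaryShift_le (∑ i, x i).toNat (x i)
    simp only [vecShift]
    omega
  classical
  refine ⟨Nat.find hex, ?_, Nat.find_spec hex⟩
  by_contra! hlt
  cases hn : Nat.find hex with
  | zero =>
    rw [hn] at hlt
    refine hx1 (funext fun i => ?_)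
    have h₁ := hlt i
    have h₂ := hx i
    rw [vecShift_zero] at h₁
    simp only [Pi.one_apply]
    omega
  | succ n =>
    refine Nat.find_min hex (m := n) (by omega) fun i => ?_
    have h₁ := hlt i
    rw [hn, vecShift_succ_apply] at h₁
    have h₂ := le_three_mul_ternaryQuot (vecShift n x i)
    omega

/-- The position `n` of the cap is determined by the vector. -/
theorem le_of_vecShift_bounds {m n n' : ℕ} {x : Fin m → ℤ} (h₄ : ∀ i, vecShift n x i ≤ 4)
    (h₂ : ∃ i, 2 ≤ vecShift n' x i) : n' ≤ n := by
  by_contra! hlt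
  obtain ⟨i, hi⟩ := h₂
  have h : ∀ k, vecShift (n + 1 + k) x i ≤ 1 := fun k => by
    induction k with
    | zero =>
      have h₁ := three_mul_ternaryQuot_le (vecShift n x i)
      have h₂ := h₄ i
      rw [add_zero, vecShift_succ_apply]
      omega
    | succ k ih =>
      have h₁ := three_mul_ternaryQuot_le (vecShift (n + 1 + k) x i)
      rw [← add_assoc, vecShift_succ_apply]
      omega
  obtain ⟨k, rfl⟩ := Nat.exists_eq_add_of_le hlt
  have := h k
  simp only [Nat.succ_eq_add_one] at hi
  omega

theorem evalWord_univ (m : ℕ) :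
    evalWord (signWord (Finset.univ : Finset (Fin m)) 1) = horocyclic (1 : Fin m → ℤ) := by
  rw [evalWord_signWord]
  congr 1
  funext i
  simp

/-- The words of the language that have a cap spell positive vectors other than `(1, …, 1)`. -/
theorem ne_one_of_vecShift {m n : ℕ} {x : Fin m → ℤ} (h₂ : ∃ i, 2 ≤ vecShift n x i) : x ≠ 1 := by
  rintro rfl
  have h := le_of_vecShift_bounds (n := 0) (fun i => by simp) h₂
  obtain rfl : n = 0 := by omega
  obtain ⟨i, hi⟩ := h₂
  simp at hi

theorem normalLanguage_subset_fullLanguage {m : ℕ} {w : List (Letter m)}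
    (hw : w ∈ normalLanguage m) : w ∈ fullLanguage m := by
  obtain hw | ⟨n, φ, p, P, hP, -, hw⟩ := hw
  exacts [Or.inl hw, Or.inr ⟨n, φ, p, P, hP, hw⟩]

theorem exists_horocyclic_of_mem_fullLanguage {m : ℕ} {w : List (Letter m)}
    (hw : w ∈ fullLanguage m) : ∃ x : Fin m → ℤ, (∀ i, 0 < x i) ∧ evalWord w = horocyclic x ∧
      ∀ M : ℕ, (w.length : ℤ) ≤ 2 * M + ∑ i, ternaryCost M (x i) := by
  obtain hw | ⟨n, φ, p, P, hP, hw⟩ := hw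
  · rw [mem_langU.1 hw]
    refine ⟨1, fun i => one_pos, evalWord_univ m, fun M => ?_⟩
    simp [length_signWord]
  · obtain ⟨x, hx, h₂, h₄, he, hl, -⟩ := exists_wordEquiv_orthantWord hP hw
    have hx0 : 0 ≤ x := fun i => (hx i).le
    exact ⟨x, hx, he.trans (evalWord_orthantWord hx0 h₄), hl ▸ length_orthantWord_le hx0 h₂ h₄⟩

theorem eq_of_mem_normalLanguage {m : ℕ} {w : List (Letter m)} (hw : w ∈ normalLanguage m) :
    (w = signWord Finset.univ 1 ∧ evalWord w = horocyclic 1) ∨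
      ∃ (n : ℕ) (x : Fin m → ℤ), (∃ i, 2 ≤ vecShift n x i) ∧ (∀ i, vecShift n x i ≤ 4) ∧
        w = orthantWord n x ∧ evalWord w = horocyclic x := by
  obtain hw | ⟨n, φ, p, P, hP, hS, hw⟩ := hw
  · rw [mem_langU.1 hw]
    exact Or.inl ⟨rfl, evalWord_univ m⟩
  · obtain ⟨x, hx, h₂, h₄, he, -, heq⟩ := exists_wordEquiv_orthantWord hP hw
    exact Or.inr ⟨n, x, h₂, h₄, heq hS,
      he.trans (evalWord_orthantWord (fun i => (hx i).le) h₄)⟩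

theorem evalWord_injOn_normalLanguage (m : ℕ) :
    Set.InjOn evalWord {w | w ∈ normalLanguage m} := by
  intro w hw w' hw' h
  obtain ⟨rfl, he⟩ | ⟨n, x, h₂, h₄, rfl, he⟩ := eq_of_mem_normalLanguage hw <;>
  obtain ⟨rfl, he'⟩ | ⟨n', x', h₂', h₄', rfl, he'⟩ := eq_of_mem_normalLanguage hw'
  · rfl
  · exact absurd (horocyclic_injective (he'.symm.trans (h.symm.trans he))) (ne_one_of_vecShift h₂')
  · exact absurd (horocyclic_injective (he.symm.trans (h.trans he'))) (ne_one_of_vecShift h₂)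
  · obtain rfl := horocyclic_injective (he.symm.trans (h.trans he'))
    rw [le_antisymm (le_of_vecShift_bounds h₄' h₂) (le_of_vecShift_bounds h₄ h₂')]

theorem exists_normalLanguage_word {m : ℕ} {x : Fin m → ℤ} (hx : ∀ i, 0 < x i) :
    ∃ w ∈ normalLanguage m, evalWord w = horocyclic x := by
  by_cases hx1 : x = 1
  · subst hx1
    exact ⟨_, Or.inl (mem_langU.2 rfl), evalWord_univ m⟩
  · obtain ⟨n, h₂, h₄⟩ := exists_vecShift_le_four hx hx1
    exact ⟨_, orthantWord_mem_normalLanguage hx h₂ h₄,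
      evalWord_orthantWord (fun i => (hx i).le) h₄⟩

theorem theorem3p1 (m : ℕ) (hm : 0 < m) :
    (∀ w ∈ normalLanguage m, IsGeodesic w) ∧
    Set.BijOn evalWord {w | w ∈ normalLanguage m} (positiveOrthant m) ∧
    (∀ w ∈ fullLanguage m, IsGeodesic w) ∧
    evalWord '' {w | w ∈ fullLanguage m} = positiveOrthant m := by
  have hgeo : ∀ w ∈ fullLanguage m, IsGeodesic w := fun w hw => by
    obtain ⟨x, -, he, hl⟩ := exists_horocyclic_of_mem_fullLanguage hw
    exact isGeodesic_of_length_le_cost hm he hl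
  have hmaps : ∀ w ∈ fullLanguage m, evalWord w ∈ positiveOrthant m := fun w hw => by
    obtain ⟨x, hx, he, -⟩ := exists_horocyclic_of_mem_fullLanguage hw
    exact ⟨x, hx, he⟩
  refine ⟨fun w hw => hgeo w (normalLanguage_subset_fullLanguage hw),
    ⟨fun w hw => hmaps w (normalLanguage_subset_fullLanguage hw),
      evalWord_injOn_normalLanguage m, ?_⟩, hgeo, ?_⟩
  · rintro _ ⟨x, hx, rfl⟩
    exact exists_normalLanguage_word hx
  · refine Set.Subset.antisymm ?_ ?_
    · rintro _ ⟨w, hw, rfl⟩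
      exact hmaps w hw
    · rintro _ ⟨x, hx, rfl⟩
      obtain ⟨w, hw, he⟩ := exists_normalLanguage_word hx
      exact ⟨w, normalLanguage_subset_fullLanguage hw, he⟩
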